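/- Let $P=(V,\le)$ be a poset, possibly infinite. A realizer of $P$ is a set $\mathcal{E}$ of linear orders on $V$ whose intersection is $\le$. The dimension of $P$ is the least cardinality of a realizer of $P$, and $P$ is uniquely realizable if it has exactly one realizer with at most two elements. The incomparability graph $\mathrm{Inc}(P)$ has vertex set $V$, two vertices being adjacent when they are incomparable in $P$. A connected component of this graph is nontrivial if it has at least two vertices. A module of a poset $Q$ is a subset $A$ of $Q$ such that for all $a,a'\in A$ and all $v\in Q\setminus A$, $v\le a$ implies $v\le a'$, and $a\le v$ implies $a'\le v$; it is proper if $A\neq Q$. Theorem. Let $P$ be a poset of dimension two. Then $P$ is uniquely realizable if and only if at most one connected component of $\mathrm{Inc}(P)$ is nontrivial and, if there is a nontrivial component, every proper module of the poset induced by $P$ on this component is a chain. -/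

import Mathlib

/-- The incomparability graph of a poset: distinct vertices are adjacent when they are
incomparable. -/
def incGraph (V : Type*) [PartialOrder V] : SimpleGraph V where
  Adj x y := IncompRel (· ≤ ·) x y
  symm := ⟨fun _ _ h => ⟨h.2, h.1⟩⟩
  loopless := ⟨fun _ h => h.1 le_rfl⟩

/-- A realizer of the poset `V`: a set of linear orders on `V` whose intersection is the order
of `V`. -/
def IsRealizer (V : Type*) [PartialOrder V] (E : Set (V → V → Prop)) : Prop :=
  (∀ r ∈ E, IsLinearOrder V r) ∧ ∀ x y : V, x ≤ y ↔ ∀ r ∈ E, r x y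

/-- The dimension of a poset: the least cardinality of a realizer. -/
noncomputable def posetDim (V : Type*) [PartialOrder V] : Cardinal :=
  sInf {c | ∃ E : Set (V → V → Prop), IsRealizer V E ∧ Cardinal.mk E = c}

/-- A poset is uniquely realizable if it has exactly one realizer with at most two elements. -/
def UniquelyRealizable (V : Type*) [PartialOrder V] : Prop :=
  ∃! E : Set (V → V → Prop), IsRealizer V E ∧ Cardinal.mk E ≤ 2

/-- A module of a binary relation `r` on `V`: a subset whose elements are not distinguished
by `r` from any point outside of it. -/
def IsRelModule {V : Type*} (r : V → V → Prop) (A : Set V) : Prop :=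
  ∀ a ∈ A, ∀ a' ∈ A, ∀ v ∉ A, (r v a → r v a') ∧ (r a v → r a' v)

/-! Two linear orders realizing `V` are opposite on incomparable pairs, so a two-element realizer
amounts to a transitive orientation of `incGraph V` up to reversal
(`uniquelyRealizable_iff_orientations`). Uniqueness thus means that such an orientation is unique up
to reversal. If a module of the graph contains an edge and some other edge is not inside it, the
orientation can be reversed on the module alone, which breaks uniqueness
(`no_module_of_orientation_unique`). Both a nontrivial component, when there is a second one, and a
proper non-chain module of a component are of this kind. Conversely, Gallai's forcing relation on
edges fixes an orientation on a whole class once it is known on one edge. The vertices spanned by a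
class form a module of the poset that is not a chain (`le_of_mem_forcedSpan`), so under the
hypotheses every class spans the only nontrivial component. Two classes with this same span coincide
(`forced_of_common_vertex`), hence there is one class. -/

/-- A transitive orientation of a graph, as a strict order. -/
structure IsTransOrientation {V : Type*} (G : SimpleGraph V) (Q : V → V → Prop) : Prop where
  trans : ∀ x y z, Q x y → Q y z → Q x z
  asymm : ∀ x y, Q x y → ¬ Q y x
  adj_iff : ∀ x y, G.Adj x y ↔ Q x y ∨ Q y x

theorem IsTransOrientation.swap {V : Type*} {G : SimpleGraph V} {Q : V → V → Prop}
    (h : IsTransOrientation G Q) : IsTransOrientation G (Function.swap Q) where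
  trans x y z h1 h2 := h.trans z y x h2 h1
  asymm x y h1 h2 := h.asymm y x h1 h2
  adj_iff x y := (h.adj_iff x y).trans or_comm

theorem incGraph_adj {V : Type*} [PartialOrder V] {x y : V} :
    (incGraph V).Adj x y ↔ ¬ x ≤ y ∧ ¬ y ≤ x := Iff.rfl

/-- The extension of the order of `V` by a relation `Q`. -/
def orderSup (V : Type*) [PartialOrder V] (Q : V → V → Prop) (x y : V) : Prop :=
  x ≤ y ∨ Q x y

/-! ### Two-element realizers and transitive orientations -/

section Realizers

variable {V : Type*} [PartialOrder V] {Q Q' : V → V → Prop}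

/-- In the mixed cases of transitivity, any other relation between `x` and `z` would make an
incomparable pair comparable, or orient a comparable one. -/
theorem isLinearOrder_orderSup (h : IsTransOrientation (incGraph V) Q) :
    IsLinearOrder V (orderSup V Q) where
  refl x := Or.inl le_rfl
  trans x y z h1 h2 := by
    have hxy := h.adj_iff x y
    have hyz := h.adj_iff y z
    have hxz := h.adj_iff x z
    rw [incGraph_adj] at hxy hyz hxz
    rcases h1 with h1 | h1 <;> rcases h2 with h2 | h2
    · exact Or.inl (h1.trans h2)
    · by_cases hle : x ≤ z
      · exact Or.inl hle
      · have hn : ¬ z ≤ x := fun hz => (hyz.2 (Or.inl h2)).2 (hz.trans h1)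
        rcases hxz.1 ⟨hle, hn⟩ with h3 | h3
        · exact Or.inr h3
        · exact absurd h1 (hxy.2 (Or.inr (h.trans _ _ _ h2 h3))).1
    · by_cases hle : x ≤ z
      · exact Or.inl hle
      · have hn : ¬ z ≤ x := fun hz => (hxy.2 (Or.inl h1)).2 (h2.trans hz)
        rcases hxz.1 ⟨hle, hn⟩ with h3 | h3
        · exact Or.inr h3
        · exact absurd h2 (hyz.2 (Or.inr (h.trans _ _ _ h3 h1))).1
    · exact Or.inr (h.trans _ _ _ h1 h2)
  antisymm x y h1 h2 := by
    have hxy := h.adj_iff x y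
    rw [incGraph_adj] at hxy
    rcases h1 with h1 | h1 <;> rcases h2 with h2 | h2
    · exact le_antisymm h1 h2
    · exact absurd h1 (hxy.2 (Or.inr h2)).1
    · exact absurd h2 (hxy.2 (Or.inl h1)).2
    · exact absurd h2 (h.asymm _ _ h1)
  total x y := by
    have hxy := h.adj_iff x y
    rw [incGraph_adj] at hxy
    unfold orderSup
    tauto

/-- The realizer determined by a transitive orientation of the incomparability graph. -/
def orientationRealizer (V : Type*) [PartialOrder V] (Q : V → V → Prop) :
    Set (V → V → Prop) :=
  {orderSup V Q, orderSup V (Function.swap Q)}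

theorem isRealizer_orientationRealizer (h : IsTransOrientation (incGraph V) Q) :
    IsRealizer V (orientationRealizer V Q) := by
  refine ⟨?_, fun x y => ⟨?_, fun H => ?_⟩⟩
  · rintro r (rfl | rfl)
    · exact isLinearOrder_orderSup h
    · exact isLinearOrder_orderSup h.swap
  · rintro hxy r (rfl | rfl) <;> exact Or.inl hxy
  · rcases H _ (Or.inl rfl) with h1 | h1
    · exact h1
    · rcases H _ (Or.inr rfl) with h2 | h2
      · exact h2
      · exact absurd h2 (h.asymm _ _ h1)

theorem mk_orientationRealizer_le (Q : V → V → Prop) :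
    Cardinal.mk (orientationRealizer V Q) ≤ 2 := by
  refine (Cardinal.mk_insert_le).trans ?_
  rw [Cardinal.mk_singleton, one_add_one_eq_two]

theorem orderSup_injective (h : IsTransOrientation (incGraph V) Q)
    (h' : IsTransOrientation (incGraph V) Q') (e : orderSup V Q = orderSup V Q') : Q = Q' := by
  funext x y
  have e1 : (x ≤ y ∨ Q x y) = (x ≤ y ∨ Q' x y) := congrFun (congrFun e x) y
  have h1 := h.adj_iff x y
  have h2 := h'.adj_iff x y
  rw [incGraph_adj] at h1 h2
  apply propext
  have e2 := Iff.of_eq e1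
  tauto

theorem eq_or_eq_swap_of_orientationRealizer_eq (h : IsTransOrientation (incGraph V) Q)
    (h' : IsTransOrientation (incGraph V) Q')
    (e : orientationRealizer V Q = orientationRealizer V Q') :
    Q = Q' ∨ Q = Function.swap Q' := by
  have hm : orderSup V Q ∈ orientationRealizer V Q' := e ▸ Or.inl rfl
  rcases hm with hm | hm
  · exact Or.inl (orderSup_injective h h' hm)
  · exact Or.inr (orderSup_injective h h'.swap hm)

theorem orientationRealizer_swap (Q : V → V → Prop) :
    orientationRealizer V (Function.swap Q) = orientationRealizer V Q :=
  Set.pair_comm _ _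

theorem exists_orientation_of_isRealizer_pair {r s : V → V → Prop}
    (h : IsRealizer V {r, s}) :
    ∃ Q, IsTransOrientation (incGraph V) Q ∧ orientationRealizer V Q = {r, s} := by
  obtain ⟨hlin, hle⟩ := h
  have hr : IsLinearOrder V r := hlin r (Or.inl rfl)
  have hs : IsLinearOrder V s := hlin s (Or.inr rfl)
  have hle' : ∀ x y, x ≤ y ↔ r x y ∧ s x y := fun x y => by
    rw [hle]
    simp
  have rt : ∀ x y, r x y ∨ r y x := fun x y => hr.total x y
  have st : ∀ x y, s x y ∨ s y x := fun x y => hs.total x y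
  have ra : ∀ x y, r x y → r y x → x = y := fun x y => hr.antisymm x y
  have sa : ∀ x y, s x y → s y x → x = y := fun x y => hs.antisymm x y
  have rtr : ∀ x y z, r x y → r y z → r x z := fun x y z => hr.trans x y z
  have str : ∀ x y z, s x y → s y z → s x z := fun x y z => hs.trans x y z
  have rn : ∀ x y, ¬ r x y → r y x ∧ ∀ _ : s y x, ¬ s x y := fun x y hn =>
    ⟨(rt x y).resolve_left hn, fun h1 h2 => hn (sa x y h2 h1 ▸ (or_self_iff.1 (rt x x)))⟩
  have sn : ∀ x y, ¬ s x y → s y x ∧ ∀ _ : r y x, ¬ r x y := fun x y hn =>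
    ⟨(st x y).resolve_left hn, fun h1 h2 => hn (ra x y h2 h1 ▸ (or_self_iff.1 (st x x)))⟩
  -- The edges are the pairs on which `r` and `s` disagree; each is oriented as in `r`.
  refine ⟨fun x y => r x y ∧ ¬ s x y, ⟨?_, ?_, ?_⟩, ?_⟩
  · rintro x y z ⟨h1, h2⟩ ⟨h3, h4⟩
    refine ⟨rtr _ _ _ h1 h3, fun h5 => ?_⟩
    have h6 := (sn _ _ h2).1
    exact h4 (str _ _ _ h6 h5)
  · rintro x y ⟨h1, h2⟩ ⟨h3, h4⟩
    exact (sn _ _ h2).2 h3 h1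
  · intro x y
    rw [incGraph_adj, hle', hle']
    have h1 := rn x y
    have h2 := sn x y
    have h3 := rn y x
    have h4 := sn y x
    tauto
  · have e1 : orderSup V (fun x y => r x y ∧ ¬ s x y) = r := by
      funext x y
      apply propext
      show x ≤ y ∨ (r x y ∧ ¬ s x y) ↔ r x y
      rw [hle']
      tauto
    have e2 : orderSup V (Function.swap fun x y => r x y ∧ ¬ s x y) = s := by
      funext x y
      apply propext
      show x ≤ y ∨ (r y x ∧ ¬ s y x) ↔ s x y
      rw [hle']
      have h1 := rn x y
      have h2 := sn y x
      tauto
    rw [orientationRealizer, e1, e2]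

theorem exists_orientation_of_isRealizer (hdim : posetDim V = 2) {E : Set (V → V → Prop)}
    (hE : IsRealizer V E) (hc : Cardinal.mk E ≤ 2) :
    ∃ Q, IsTransOrientation (incGraph V) Q ∧ orientationRealizer V Q = E := by
  have hge : 2 ≤ Cardinal.mk E := hdim ▸ csInf_le' ⟨E, hE, rfl⟩
  obtain ⟨r, s, -, hrs⟩ := Cardinal.mk_eq_two_iff.1 (le_antisymm hc hge)
  have he : E = {(r : V → V → Prop), (s : V → V → Prop)} := by
    rw [← Set.image_pair, hrs, Set.image_univ, Subtype.range_coe]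
  rw [he] at hE ⊢
  exact exists_orientation_of_isRealizer_pair hE

theorem exists_orientation (hdim : posetDim V = 2) :
    ∃ Q, IsTransOrientation (incGraph V) Q := by
  have hne : {c | ∃ E : Set (V → V → Prop), IsRealizer V E ∧ Cardinal.mk E = c}.Nonempty := by
    by_contra hn
    rw [Set.not_nonempty_iff_eq_empty] at hn
    -- Without any realizer the infimum would take its default value 0, not 2.
    rw [posetDim, hn, Cardinal.sInf_empty] at hdim
    exact two_ne_zero hdim.symm
  obtain ⟨E, hE, hc⟩ := csInf_mem hne
  obtain ⟨Q, hQ, -⟩ := exists_orientation_of_isRealizer hdim hE (hc.trans hdim).le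
  exact ⟨Q, hQ⟩

theorem uniquelyRealizable_iff_orientations (hdim : posetDim V = 2) :
    UniquelyRealizable V ↔ ∀ Q Q' : V → V → Prop, IsTransOrientation (incGraph V) Q →
      IsTransOrientation (incGraph V) Q' → Q = Q' ∨ Q = Function.swap Q' := by
  constructor
  · intro hu Q Q' h h'
    exact eq_or_eq_swap_of_orientationRealizer_eq h h' (hu.unique
      ⟨isRealizer_orientationRealizer h, mk_orientationRealizer_le Q⟩
      ⟨isRealizer_orientationRealizer h', mk_orientationRealizer_le Q'⟩)
  · intro H
    obtain ⟨Q, hQ⟩ := exists_orientation hdim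
    refine ⟨orientationRealizer V Q,
      ⟨isRealizer_orientationRealizer hQ, mk_orientationRealizer_le Q⟩, ?_⟩
    rintro E ⟨hE, hc⟩
    obtain ⟨Q', hQ', rfl⟩ := exists_orientation_of_isRealizer hdim hE hc
    rcases H Q' Q hQ' hQ with rfl | rfl
    · rfl
    · exact orientationRealizer_swap Q

end Realizers

/-! ### Reorienting a graph inside a module -/

section Substitution

variable {V : Type*} {G : SimpleGraph V} {Q R : V → V → Prop} {A : Set V} {a : V}

open Classical in
/-- The relation that is `R` inside `A`, and elsewhere is `Q` with `A` contracted to `a`. -/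
def substRel (Q R : V → V → Prop) (A : Set V) (a : V) (x y : V) : Prop :=
  if x ∈ A then (if y ∈ A then R x y else Q a y) else (if y ∈ A then Q x a else Q x y)

theorem IsTransOrientation.substRel (hQ : IsTransOrientation G Q) (hR : IsTransOrientation G R)
    (ha : a ∈ A) (hA : ∀ x ∈ A, ∀ y ∈ A, ∀ v ∉ A, G.Adj v x → G.Adj v y) :
    IsTransOrientation G (substRel Q R A a) where
  trans x y z := by
    have h1 := hQ.trans
    have h2 := hR.trans
    have h3 := hQ.asymm
    unfold _root_.substRel
    by_cases hx : x ∈ A <;> by_cases hy : y ∈ A <;> by_cases hz : z ∈ A <;>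
      simp only [hx, hy, hz, if_true, if_false] <;> intro h h'
    · exact h2 _ _ _ h h'
    · exact h'
    · exact absurd h' (h3 _ _ h)
    · exact h1 _ _ _ h h'
    · exact h
    · exact h1 _ _ _ h h'
    · exact h1 _ _ _ h h'
    · exact h1 _ _ _ h h'
  asymm x y := by
    unfold _root_.substRel
    by_cases hx : x ∈ A <;> by_cases hy : y ∈ A <;>
      simp only [hx, hy, if_true, if_false]
    · exact hR.asymm _ _
    all_goals exact hQ.asymm _ _
  adj_iff x y := by
    unfold _root_.substRel
    by_cases hx : x ∈ A <;> by_cases hy : y ∈ A <;>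
      simp only [hx, hy, if_true, if_false]
    · exact hR.adj_iff _ _
    · rw [← hQ.adj_iff, G.adj_comm x, G.adj_comm a]
      exact ⟨hA x hx a ha y hy, hA a ha x hx y hy⟩
    · rw [← hQ.adj_iff]
      exact ⟨hA y hy a ha x hx, hA a ha y hy x hx⟩
    · exact hQ.adj_iff _ _

/-- A graph whose transitive orientations are unique up to reversal has no module that contains
some, but not all, of the edges. -/
theorem no_module_of_orientation_unique
    (H : ∀ Q Q' : V → V → Prop, IsTransOrientation G Q →
      IsTransOrientation G Q' → Q = Q' ∨ Q = Function.swap Q')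
    (hQ : IsTransOrientation G Q)
    (hA : ∀ x ∈ A, ∀ y ∈ A, ∀ v ∉ A, G.Adj v x → G.Adj v y)
    {b c d : V} (ha : a ∈ A) (hb : b ∈ A) (hab : G.Adj a b) (hc : c ∉ A)
    (hcd : G.Adj c d) : False := by
  -- `Q` itself need not treat `A` uniformly, so two substitutions are compared: they differ on
  -- `ab`, inside `A`, and agree on `cd`, as `c` is outside.
  have h1 := hQ.substRel hQ ha hA
  have h2 := hQ.substRel hQ.swap ha hA
  rcases H _ _ h1 h2 with e | e
  · have e1 := Iff.of_eq (congrFun (congrFun e a) b)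
    have e2 := Iff.of_eq (congrFun (congrFun e b) a)
    simp only [substRel, ha, hb, if_true, Function.swap] at e1 e2
    have h3 := hQ.asymm a b
    have h4 := (hQ.adj_iff a b).1 hab
    tauto
  · have e1 := Iff.of_eq (congrFun (congrFun e c) d)
    have e2 := Iff.of_eq (congrFun (congrFun e d) c)
    have h3 := (h1.adj_iff c d).1 hcd
    have h4 := h1.asymm c d
    have h5 : substRel Q (Function.swap Q) A a d c = substRel Q Q A a d c := by
      simp [substRel, hc]
    simp only [Function.swap] at e1 h5
    rw [h5] at e1
    tauto

end Substitution

/-! ### Forcing classes of edges -/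

section Forcing

variable {V : Type*} {G : SimpleGraph V}

/-- One step of the forcing relation on ordered edges of `G`: reversal, or the replacement of an
endpoint by a vertex not adjacent to it. -/
def ForcingStep (G : SimpleGraph V) (p q : V × V) : Prop :=
  G.Adj p.1 p.2 ∧ G.Adj q.1 q.2 ∧ (q = p.swap ∨ (p.1 = q.1 ∧ ¬ G.Adj p.2 q.2))

/-- The edge `xy` is forced by the edge `ab`. -/
def Forced (G : SimpleGraph V) (a b x y : V) : Prop :=
  Relation.ReflTransGen (ForcingStep G) (a, b) (x, y)

theorem ForcingStep.symm {p q : V × V} (h : ForcingStep G p q) : ForcingStep G q p := by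
  obtain ⟨h1, h2, h3⟩ := h
  refine ⟨h2, h1, ?_⟩
  rcases h3 with rfl | ⟨h3, h4⟩
  · exact Or.inl (Prod.swap_swap p).symm
  · exact Or.inr ⟨h3.symm, fun h => h4 h.symm⟩

theorem Forced.symm {a b x y : V} (h : Forced G a b x y) : Forced G x y a b :=
  haveI : Std.Symm (ForcingStep G) := ⟨fun _ _ => ForcingStep.symm⟩
  Relation.ReflTransGen.stdSymm.symm _ _ h

theorem Forced.trans {a b c d x y : V} (h : Forced G a b c d) (h' : Forced G c d x y) :
    Forced G a b x y :=
  Relation.ReflTransGen.trans h h'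

/-- Induction over a forcing class. -/
theorem Forced.induct {a b x y : V} (h : Forced G a b x y) (hab : G.Adj a b)
    {p : V → V → Prop} (h0 : p a b)
    (hswap : ∀ x y, Forced G a b x y → G.Adj x y → p x y → p y x)
    (hstep : ∀ x y y', Forced G a b x y → G.Adj x y → G.Adj x y' → ¬ G.Adj y y' →
      p x y → p x y') :
    G.Adj x y ∧ p x y := by
  have key : ∀ q : V × V, Relation.ReflTransGen (ForcingStep G) (a, b) q →
      G.Adj q.1 q.2 ∧ p q.1 q.2 := by
    intro q hq
    induction hq with
    | refl => exact ⟨hab, h0⟩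
    | @tail q q' hq hs ih =>
      obtain ⟨x, y⟩ := q
      obtain ⟨x', y'⟩ := q'
      obtain ⟨h1, h2, h3⟩ := hs
      refine ⟨h2, ?_⟩
      rcases h3 with h3 | ⟨h3, h4⟩
      · simp only [Prod.swap_prod_mk, Prod.mk.injEq] at h3
        obtain ⟨rfl, rfl⟩ := h3
        exact hswap _ _ hq h1 ih.2
      · simp only at h3 h4
        subst h3
        exact hstep _ _ _ hq h1 h2 h4 ih.2
  exact key (x, y) h

theorem Forced.adj {a b x y : V} (h : Forced G a b x y) (hab : G.Adj a b) : G.Adj x y :=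
  (h.induct (p := fun _ _ => True) hab trivial (fun _ _ _ _ _ => trivial)
    (fun _ _ _ _ _ _ _ _ => trivial)).1

theorem Forced.swap {a b x y : V} (h : Forced G a b x y) (hab : G.Adj a b) :
    Forced G a b y x :=
  Relation.ReflTransGen.tail h ⟨h.adj hab, (h.adj hab).symm, Or.inl rfl⟩

theorem Forced.step {a b x y z : V} (h : Forced G a b x y) (hab : G.Adj a b)
    (hxz : G.Adj x z) (hyz : ¬ G.Adj y z) : Forced G a b x z :=
  Relation.ReflTransGen.tail h ⟨h.adj hab, hxz, Or.inr ⟨rfl, hyz⟩⟩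

/-- The set of endpoints of the edges forced by `ab`. -/
def forcedSpan (G : SimpleGraph V) (a b : V) : Set V := {x | ∃ y, Forced G a b x y}

/-- If `v`, `x`, `y` form a triangle in which only `xy` is in the class of `ab`, then `v` is
joined to the whole class by edges outside of the class. -/
theorem Forced.triangle {a b v x y x' y' : V} (hab : G.Adj a b) (hxy : Forced G a b x y)
    (hvx : G.Adj v x) (hvy : G.Adj v y) (hx : ¬ Forced G a b v x) (hy : ¬ Forced G a b v y)
    (h' : Forced G a b x' y') : G.Adj v x' ∧ ¬ Forced G a b v x' := by
  -- The claim is carried for both endpoints, so that reversal preserves it.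
  have key := (hxy.symm.trans h').induct (hxy.adj hab)
    (p := fun z w => (G.Adj v z ∧ ¬ Forced G a b v z) ∧ (G.Adj v w ∧ ¬ Forced G a b v w))
    ⟨⟨hvx, hx⟩, hvy, hy⟩ (fun _ _ _ _ h => h.symm) ?_
  · exact key.2.1
  · rintro z w w' hzw hadj hadj' hn ⟨⟨h1, h2⟩, h3, h4⟩
    have hzw' : Forced G a b z w' := (hxy.trans hzw).step hab hadj' hn
    -- Otherwise `zw'` would force `zv`. Likewise `vw'` in the class would force `vw`.
    have hvw' : G.Adj v w' := by
      by_contra hc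
      exact h2 ((hzw'.step hab h1.symm (fun h => hc h.symm)).swap hab)
    exact ⟨⟨h1, h2⟩, hvw', fun hf => h4 (hf.step hab h3 (fun h => hn h.symm))⟩

theorem mem_forcedSpan {a b x y : V} (h : Forced G a b x y) : x ∈ forcedSpan G a b := ⟨y, h⟩

/-- The span of a forcing class is a module of the graph. -/
theorem forcedSpan_module {a b x y v : V} (hab : G.Adj a b) (hx : x ∈ forcedSpan G a b)
    (hy : y ∈ forcedSpan G a b) (hv : v ∉ forcedSpan G a b) (hvx : G.Adj v x) : G.Adj v y := by
  obtain ⟨x', hx⟩ := hx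
  obtain ⟨y', hy⟩ := hy
  have hn : ∀ z, ¬ Forced G a b v z := fun z hz => hv ⟨z, hz⟩
  have hvx' : G.Adj v x' := by
    by_contra hc
    exact hn x ((hx.step hab hvx.symm (fun h => hc h.symm)).swap hab)
  exact (hx.triangle hab hvx hvx' (hn _) (hn _) hy).1

/-- Two forcing classes coincide if their spans share a vertex and are both closed under
adjacency. -/
theorem forced_of_common_vertex {a b c d x : V} (hab : G.Adj a b) (hcd : G.Adj c d)
    (hx : x ∈ forcedSpan G a b) (hx' : x ∈ forcedSpan G c d)
    (h : ∀ v y, v ∈ forcedSpan G a b → G.Adj v y → y ∈ forcedSpan G a b)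
    (h' : ∀ v y, v ∈ forcedSpan G c d → G.Adj v y → y ∈ forcedSpan G c d) :
    Forced G a b c d := by
  obtain ⟨y, hy⟩ := hx
  obtain ⟨z, hz⟩ := hx'
  by_contra hne
  have hdis : ∀ u v, Forced G a b u v → ¬ Forced G c d u v :=
    fun u v h1 h2 => hne (h1.trans h2.symm)
  -- Otherwise `xy` would force `xz`, merging the two classes.
  have hyz : G.Adj y z := by
    by_contra hc
    exact hdis _ _ (hy.step hab (hz.adj hcd) hc) hz
  -- Otherwise the triangle lemma joins `z` to the whole span of `ab`, which contains `z` itself. By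
  -- symmetry `yz` is also in the class of `cd`, a contradiction.
  have h1 : Forced G a b y z := by
    by_contra hc
    have hzs := h _ _ (mem_forcedSpan (hy.swap hab)) hyz
    obtain ⟨w, hw⟩ := hzs
    exact (hy.triangle hab (hz.adj hcd).symm hyz.symm
      (fun hf => hdis _ _ (hf.swap hab) hz) (fun hf => hc (hf.swap hab)) hw).1.ne rfl
  have hys := h' _ _ (mem_forcedSpan (hz.swap hcd)) hyz.symm
  obtain ⟨w, hw⟩ := hys
  exact (hz.triangle hcd (hy.adj hab).symm hyz (fun hf => hdis _ _ hy (hf.swap hcd))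
    (hdis _ _ h1) hw).1.ne rfl

/-- Whether two transitive orientations agree is constant on forcing classes. -/
theorem Forced.agree_iff {Q R : V → V → Prop} (hQ : IsTransOrientation G Q)
    (hR : IsTransOrientation G R) {a b x y : V} (hab : G.Adj a b) (h : Forced G a b x y) :
    (Q x y ↔ R x y) ↔ (Q a b ↔ R a b) := by
  refine (h.induct (p := fun x y => (Q x y ↔ R x y) ↔ (Q a b ↔ R a b)) hab Iff.rfl ?_ ?_).2
  · intro x y _ hxy ih
    have h1 := (hQ.adj_iff x y).1 hxy
    have h2 := (hR.adj_iff x y).1 hxy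
    have h3 := hQ.asymm x y
    have h4 := hR.asymm x y
    tauto
  · intro x y z _ hxy hxz hyz ih
    -- If one edge entered `x` and the other left it, transitivity would orient the non-edge `yz`.
    have key : ∀ {S : V → V → Prop}, IsTransOrientation G S → (S x y ↔ S x z) := by
      intro S hS
      have h1 := (hS.adj_iff x y).1 hxy
      have h2 := (hS.adj_iff x z).1 hxz
      have h3 : ¬ (S y z ∨ S z y) := fun h => hyz ((hS.adj_iff y z).2 h)
      have h4 := hS.trans y x z
      have h5 := hS.trans z x y
      have h6 := hS.asymm x y
      have h7 := hS.asymm x z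
      tauto
    rw [← key hQ, ← key hR]
    exact ih

/-- If all edges lie in one forcing class, transitive orientations are unique up to reversal. -/
theorem orientation_unique_of_forced
    (H : ∀ a b x y, G.Adj a b → G.Adj x y → Forced G a b x y) {Q R : V → V → Prop}
    (hQ : IsTransOrientation G Q) (hR : IsTransOrientation G R) :
    Q = R ∨ Q = Function.swap R := by
  by_cases hag : ∀ x y, G.Adj x y → (Q x y ↔ R x y)
  · left
    funext x y
    apply propext
    by_cases hxy : G.Adj x y
    · exact hag x y hxy
    · have h1 := hQ.adj_iff x y
      have h2 := hR.adj_iff x y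
      tauto
  · push Not at hag
    obtain ⟨a, b, hab, hne⟩ := hag
    right
    funext x y
    apply propext
    have h1 := hQ.adj_iff x y
    have h2 := hR.adj_iff x y
    by_cases hxy : G.Adj x y
    · have h3 := (H a b x y hab hxy).agree_iff hQ hR hab
      have h4 := hR.asymm x y
      have h5 : ¬ (Q a b ↔ R a b) := by tauto
      show Q x y ↔ R y x
      tauto
    · show Q x y ↔ R y x
      tauto

end Forcing

/-! ### Nontrivial components and their edges -/

section Components

variable {V : Type*}

theorem supp_nontrivial_of_adj {G : SimpleGraph V} {a b : V} (hab : G.Adj a b) :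
    (G.connectedComponentMk a).supp.Nontrivial :=
  ⟨a, rfl, b, (SimpleGraph.ConnectedComponent.sound hab.reachable).symm, hab.ne⟩

theorem exists_adj_of_supp_nontrivial {G : SimpleGraph V} {C : G.ConnectedComponent}
    (hC : C.supp.Nontrivial) {a : V} (ha : a ∈ C.supp) : ∃ b ∈ C.supp, G.Adj a b := by
  obtain ⟨b, hb, hne⟩ := hC.exists_ne a
  have hr : G.Reachable a b := SimpleGraph.ConnectedComponent.exact (ha.trans hb.symm)
  obtain ⟨w⟩ := hr
  cases w with
  | nil => exact absurd rfl hne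
  | @cons _ c _ h _ =>
    exact ⟨c, (SimpleGraph.ConnectedComponent.sound h.reachable).symm.trans ha, h⟩

theorem mem_supp_of_adj {G : SimpleGraph V} {C : G.ConnectedComponent} {a b : V}
    (ha : a ∈ C.supp) (h : G.Adj a b) : b ∈ C.supp :=
  (SimpleGraph.ConnectedComponent.sound h.reachable).symm.trans ha

/-- A set of vertices that meets a component in a proper part is left by some edge of it. -/
theorem exists_adj_leaving {G : SimpleGraph V} {C : G.ConnectedComponent} {A : Set V} {a b : V}
    (ha : a ∈ C.supp) (hb : b ∈ C.supp) (haA : a ∈ A) (hbA : b ∉ A) :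
    ∃ c d, c ∉ A ∧ G.Adj c d := by
  obtain ⟨d, -, h⟩ := exists_adj_of_supp_nontrivial (C := C)
    ⟨a, ha, b, hb, fun e => hbA (e ▸ haA)⟩ hb
  exact ⟨b, d, hbA, h⟩

end Components

/-! ### Modules of the poset and the two implications -/

section Poset

variable {V : Type*} [PartialOrder V]

/-- A vertex outside of the span of a forcing class of the incomparability graph lies below all
of the span if it lies below one element of it. -/
theorem le_of_mem_forcedSpan {a b x y v : V} (hab : (incGraph V).Adj a b)
    (hx : x ∈ forcedSpan (incGraph V) a b) (hy : y ∈ forcedSpan (incGraph V) a b)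
    (hv : v ∉ forcedSpan (incGraph V) a b) :
    (v ≤ x → v ≤ y) ∧ (x ≤ v → y ≤ v) := by
  -- Comparability with `v` is constant on the span, a module of the graph. Its direction is then
  -- constant along each edge of the class, since `w ≤ v ≤ z` would make the edge `zw` comparable.
  have hcomp : ∀ z ∈ forcedSpan (incGraph V) a b, ∀ w ∈ forcedSpan (incGraph V) a b,
      (v ≤ z ∨ z ≤ v) → (v ≤ w ∨ w ≤ v) := by
    intro z hz w hw hvz
    by_contra hc
    have h1 : (incGraph V).Adj v w := by
      rw [incGraph_adj]
      tauto
    have h2 := forcedSpan_module hab hw hz hv h1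
    rw [incGraph_adj] at h2
    tauto
  obtain ⟨x', hx'⟩ := hx
  obtain ⟨y', hy'⟩ := hy
  have hxx' := hx'.adj hab
  have hmem : ∀ z w, Forced (incGraph V) x x' z w → z ∈ forcedSpan (incGraph V) a b :=
    fun z w h => ⟨w, hx'.trans h⟩
  have hfy := hx'.symm.trans hy'
  constructor
  · intro hle
    have step : ∀ z w, z ∈ forcedSpan (incGraph V) a b → w ∈ forcedSpan (incGraph V) a b →
        (incGraph V).Adj z w → v ≤ z → v ≤ w := by
      intro z w hz hw hzw hvz
      exact (hcomp z hz w hw (Or.inl hvz)).resolve_right fun h => hzw.2 (h.trans hvz)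
    refine (hfy.induct (p := fun z _ => v ≤ z) hxx' hle ?_ ?_).2
    · intro z w h hzw hvz
      exact step z w (hmem _ _ h) (hmem _ _ (h.swap hxx')) hzw hvz
    · intro z w w' _ _ _ _ hvz
      exact hvz
  · intro hle
    have step : ∀ z w, z ∈ forcedSpan (incGraph V) a b → w ∈ forcedSpan (incGraph V) a b →
        (incGraph V).Adj z w → z ≤ v → w ≤ v := by
      intro z w hz hw hzw hvz
      exact (hcomp z hz w hw (Or.inr hvz)).resolve_left fun h => hzw.1 (hvz.trans h)
    refine (hfy.induct (p := fun z _ => z ≤ v) hxx' hle ?_ ?_).2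
    · intro z w h hzw hvz
      exact step z w (hmem _ _ h) (hmem _ _ (h.swap hxx')) hzw hvz
    · intro z w w' _ _ _ _ hvz
      exact hvz

/-- No edge leaves a component, so it is a module of the graph; a second nontrivial component
supplies an edge outside it. -/
theorem components_of_orientation_unique
    (H : ∀ Q Q' : V → V → Prop, IsTransOrientation (incGraph V) Q →
      IsTransOrientation (incGraph V) Q' → Q = Q' ∨ Q = Function.swap Q')
    {Q : V → V → Prop} (hQ : IsTransOrientation (incGraph V) Q) :
    {C : (incGraph V).ConnectedComponent | C.supp.Nontrivial}.Subsingleton := by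
  intro C hC D hD
  by_contra hne
  obtain ⟨a, ha⟩ := hC.nonempty
  obtain ⟨c, hc⟩ := hD.nonempty
  obtain ⟨b, hb, hab⟩ := exists_adj_of_supp_nontrivial hC ha
  obtain ⟨d, hd, hcd⟩ := exists_adj_of_supp_nontrivial hD hc
  refine no_module_of_orientation_unique H hQ (A := C.supp) ?_ ha hb hab
    (fun hc' => hne (Eq.trans (Eq.symm hc') hc)) hcd
  intro x hx y _ v hv hvx
  exact absurd (mem_supp_of_adj hx hvx.symm) hv

/-- A module of the component is also a module of the whole graph, because vertices outside the
component have no neighbours in it. An incomparable pair in `A` is an edge inside, and a point of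
the component outside `A` lies on an edge not contained in `A`. -/
theorem isChain_of_orientation_unique
    (H : ∀ Q Q' : V → V → Prop, IsTransOrientation (incGraph V) Q →
      IsTransOrientation (incGraph V) Q' → Q = Q' ∨ Q = Function.swap Q')
    {Q : V → V → Prop} (hQ : IsTransOrientation (incGraph V) Q)
    (C : (incGraph V).ConnectedComponent) (A : Set C.supp)
    (hA : IsRelModule (fun x y : C.supp => x ≤ y) A) (hne : A ≠ Set.univ) :
    IsChain (fun x y : C.supp => x ≤ y) A := by
  intro a ha b hb _
  by_contra hab
  obtain ⟨c, hc⟩ := (Set.ne_univ_iff_exists_notMem A).1 hne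
  have hadj : (incGraph V).Adj (a : V) (b : V) := not_or.1 hab
  have hmem : ∀ z : C.supp, (z : V) ∈ Subtype.val '' A ↔ z ∈ A := fun z =>
    Subtype.val_injective.mem_set_image
  obtain ⟨u, v, hu, huv⟩ := exists_adj_leaving (A := Subtype.val '' A) a.2 c.2
    ((hmem a).2 ha) (fun h => hc ((hmem c).1 h))
  refine no_module_of_orientation_unique H hQ (A := Subtype.val '' A) ?_
    ((hmem a).2 ha) ((hmem b).2 hb) hadj hu huv
  rintro _ ⟨x, hx, rfl⟩ _ ⟨y, hy, rfl⟩ v hv hvx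
  have hvC : v ∈ C.supp := mem_supp_of_adj x.2 hvx.symm
  have h1 := hA y hy x hx ⟨v, hvC⟩ (fun h => hv ((hmem ⟨v, hvC⟩).2 h))
  exact ⟨fun h => hvx.1 (h1.1 h), fun h => hvx.2 (h1.2 h)⟩

/-- The trace of the span on `C` is a module containing the incomparable pair `a`, `b`, so it cannot
be proper. -/
theorem component_subset_forcedSpan {C : (incGraph V).ConnectedComponent}
    (hC : ∀ A : Set C.supp, IsRelModule (fun x y : C.supp => x ≤ y) A → A ≠ Set.univ →
      IsChain (fun x y : C.supp => x ≤ y) A)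
    {a b : V} (ha : a ∈ C.supp) (hab : (incGraph V).Adj a b) :
    C.supp ⊆ forcedSpan (incGraph V) a b := by
  by_contra hn
  obtain ⟨c, hc, hcn⟩ := Set.not_subset.1 hn
  have hb := mem_supp_of_adj ha hab
  have hf : Forced (incGraph V) a b a b := Relation.ReflTransGen.refl
  have hch := hC (Subtype.val ⁻¹' forcedSpan (incGraph V) a b)
    (fun x hx y hy v hv => le_of_mem_forcedSpan (x := x.1) (y := y.1) (v := v.1) hab hx hy hv)
    (fun e => hcn (e ▸ Set.mem_univ (⟨c, hc⟩ : C.supp) :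
      (⟨c, hc⟩ : C.supp) ∈ Subtype.val ⁻¹' forcedSpan (incGraph V) a b))
  have := hch (x := ⟨a, ha⟩) (mem_forcedSpan hf) (y := ⟨b, hb⟩) (mem_forcedSpan (hf.swap hab))
    (fun e => hab.ne (congrArg Subtype.val e))
  exact this.elim hab.1 hab.2

theorem forced_of_modules_chains
    (hs : {C : (incGraph V).ConnectedComponent | C.supp.Nontrivial}.Subsingleton)
    (hm : ∀ C : (incGraph V).ConnectedComponent, C.supp.Nontrivial →
      ∀ A : Set C.supp, IsRelModule (fun x y : C.supp => x ≤ y) A → A ≠ Set.univ →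
        IsChain (fun x y : C.supp => x ≤ y) A)
    (a b x y : V) (hab : (incGraph V).Adj a b) (hxy : (incGraph V).Adj x y) :
    Forced (incGraph V) a b x y := by
  -- Each span contains every non-isolated vertex, so any two spans meet and are closed under
  -- adjacency.
  have hcov : ∀ u v, (incGraph V).Adj u v → ∀ z w, (incGraph V).Adj z w →
      z ∈ forcedSpan (incGraph V) u v := by
    intro u v huv z w hzw
    refine component_subset_forcedSpan (hm _ (supp_nontrivial_of_adj huv)) rfl huv ?_
    exact hs (supp_nontrivial_of_adj hzw) (supp_nontrivial_of_adj huv)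
  exact forced_of_common_vertex hab hxy (hcov a b hab a b hab) (hcov x y hxy a b hab)
    (fun v z _ h => hcov a b hab z v h.symm) (fun v z _ h => hcov x y hxy z v h.symm)

end Poset

theorem mainTheorem10 (V : Type*) [PartialOrder V] (hdim : posetDim V = 2) :
    UniquelyRealizable V ↔
      {C : (incGraph V).ConnectedComponent | C.supp.Nontrivial}.Subsingleton ∧
      ∀ C : (incGraph V).ConnectedComponent, C.supp.Nontrivial →
        ∀ A : Set C.supp, IsRelModule (fun x y : C.supp => x ≤ y) A → A ≠ Set.univ →
          IsChain (fun x y : C.supp => x ≤ y) A := by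
  rw [uniquelyRealizable_iff_orientations hdim]
  constructor
  · intro H
    obtain ⟨Q, hQ⟩ := exists_orientation hdim
    exact ⟨components_of_orientation_unique H hQ,
      fun C _ A hA hne => isChain_of_orientation_unique H hQ C A hA hne⟩
  · rintro ⟨hs, hm⟩ Q Q' hQ hQ'
    exact orientation_unique_of_forced (forced_of_modules_chains hs hm) hQ hQ'
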